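/- Let $\mathbb{H}=\{z\in\mathbb{C}:\operatorname{Im}z>0\}$. A Pick function is a holomorphic function $\Phi:\mathbb{C}\setminus\mathbb{R}\to\mathbb{C}$ with $\operatorname{Im}\Phi(z)/\operatorname{Im}z\ge 0$ for all $z\in\mathbb{C}\setminus\mathbb{R}$ and $\Phi(z)=\overline{\Phi(\overline z)}$ for $\operatorname{Im}z<0$; let $\mathcal{P}$ be the set of Pick functions. Let $\mathcal{P}_{\log}$ be the set of all $f\in\mathcal{P}$ without zeros in $\mathbb{C}\setminus\mathbb{R}$ whose logarithmic derivative $f'/f$ also belongs to $\mathcal{P}$. For $f\in\mathcal{P}$, $x\in\mathbb{R}$ and $y>0$ write $U^{f}(x,y)=\operatorname{Re}f(x+iy)$ and $V^{f}(x,y)=\operatorname{Im}f(x+iy)$, let subscripts denote partial derivatives, and let $\arg$ be the principal argument, with values in $(-\pi,\pi]$. **Theorem.** Let $\varphi\in\mathcal{P}$ be non-constant on $\mathbb{H}$. Then each one of the following four conditions is necessary and sufficient for $\varphi\in\mathcal{P}_{\log}$: (1) $|\varphi(x+iy_1)|>|\varphi(x+iy_2)|$ for all $x\in\mathbb{R}$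 and $0<y_1<y_2<+\infty$; (2) $\arg\varphi(x_1+iy)<\arg\varphi(x_2+iy)$ for all $y>0$ and $-\infty<x_1<x_2<+\infty$; (3) $\begin{vmatrix}U^{\varphi}(x_1,y)&U^{\varphi}(x_2,y)\\V^{\varphi}(x_1,y)&V^{\varphi}(x_2,y)\end{vmatrix}>0$ for all $y>0$ and $-\infty<x_1<x_2<+\infty$; (4) $U^{\varphi}(x,y)\,U^{\varphi}_y(x,y)+V^{\varphi}(x,y)\,V^{\varphi}_y(x,y)<0$ for all $x\in\mathbb{R}$ and $y>0$. -/

import Mathlib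

/-- The class of Pick functions: holomorphic on `ℂ \ ℝ`, with `Im Φ(z) / Im z ≥ 0` there, and extended
from the upper to the lower half-plane by `Φ(z) = conj (Φ (conj z))`. Only the values off the real
axis matter. -/
def PickClass : Set (ℂ → ℂ) :=
  {Φ | DifferentiableOn ℂ Φ {z : ℂ | z.im ≠ 0} ∧
    (∀ z : ℂ, z.im ≠ 0 → 0 ≤ (Φ z).im / z.im) ∧
    ∀ z : ℂ, z.im < 0 → Φ z = (starRingEnd ℂ) (Φ ((starRingEnd ℂ) z))}

/-- The class of Pick functions `f`, without zeros off the real axis (so that the logarithmic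
derivative makes sense there), whose logarithmic derivative `f' / f` is again a Pick function. -/
def PickLogClass : Set (ℂ → ℂ) :=
  {f | f ∈ PickClass ∧ (∀ z : ℂ, z.im ≠ 0 → f z ≠ 0) ∧ logDeriv f ∈ PickClass}

/-- `U^f(x, y) = Re f(x + iy)`. -/
def pickU (f : ℂ → ℂ) (x y : ℝ) : ℝ := (f ((x : ℂ) + (y : ℂ) * Complex.I)).re

/-- `V^f(x, y) = Im f(x + iy)`. -/
def pickV (f : ℂ → ℂ) (x y : ℝ) : ℝ := (f ((x : ℂ) + (y : ℂ) * Complex.I)).im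

open Complex ComplexConjugate Set

/-! A non-constant Pick function maps the upper half-plane into itself, so the principal `log φ` is
holomorphic there with derivative `φ'/φ`. By Cauchy–Riemann, `Im (φ'/φ) = ∂ₓ arg φ = -∂_y log |φ|`,
and membership in `PickLogClass` is a sign condition on this one quantity. (1) and (2) are its two
monotonicity forms, (3) rewrites (2) through the sine of the difference of arguments, and (4) is the
sign of `∂_y |φ|² / 2`. Strict monotonicity only gives `Im (φ'/φ) ≥ 0`, which suffices for
membership. Conversely, the open mapping theorem upgrades `≥ 0` to `> 0` unless `φ'/φ` is a real
constant, which is impossible. -/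

/-- A holomorphic function on the upper half-plane with nonnegative imaginary part is either
constant there or has positive imaginary part everywhere. -/
theorem im_pos_or_const_of_im_nonneg {f : ℂ → ℂ} (hf : DifferentiableOn ℂ f {z : ℂ | 0 < z.im})
    (h0 : ∀ z : ℂ, 0 < z.im → 0 ≤ (f z).im) :
    (∃ c, ∀ z : ℂ, 0 < z.im → f z = c) ∨ ∀ z : ℂ, 0 < z.im → 0 < (f z).im := by
  have hopen : IsOpen {z : ℂ | 0 < z.im} := isOpen_lt continuous_const continuous_im
  rcases (hf.analyticOnNhd hopen).is_constant_or_isOpen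
    (convex_halfSpace_im_gt 0).isPreconnected with hc | hmap
  · exact Or.inl hc
  · right
    -- An open image inside the closed half-plane lies in its interior.
    have himg : f '' {z : ℂ | 0 < z.im} ⊆ interior {w : ℂ | 0 ≤ w.im} := by
      refine interior_maximal ?_ (hmap _ subset_rfl hopen)
      rintro _ ⟨z, hz, rfl⟩
      exact h0 z hz
    intro z hz
    have h := himg (mem_image_of_mem f hz)
    rwa [interior_setOfPred_le_im] at h

namespace PickClass

variable {φ : ℂ → ℂ}

theorem differentiableAt (hφ : φ ∈ PickClass) {z : ℂ} (hz : z.im ≠ 0) :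
    DifferentiableAt ℂ φ z :=
  hφ.1.differentiableAt ((isOpen_ne_fun continuous_im continuous_const).mem_nhds hz)

theorem im_nonneg (hφ : φ ∈ PickClass) {z : ℂ} (hz : 0 < z.im) : 0 ≤ (φ z).im := by
  simpa [div_mul_cancel₀ _ hz.ne'] using mul_nonneg (hφ.2.1 z hz.ne') hz.le

theorem im_pos (hφ : φ ∈ PickClass) (hc : ¬ ∃ c : ℂ, ∀ z : ℂ, 0 < z.im → φ z = c)
    {z : ℂ} (hz : 0 < z.im) : 0 < (φ z).im :=
  (im_pos_or_const_of_im_nonneg (fun _ hw => (differentiableAt hφ hw.ne').differentiableWithinAt)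
    fun _ hw => im_nonneg hφ hw).resolve_left hc z hz

theorem ne_zero (hφ : φ ∈ PickClass) (hc : ¬ ∃ c : ℂ, ∀ z : ℂ, 0 < z.im → φ z = c)
    {z : ℂ} (hz : 0 < z.im) : φ z ≠ 0 := fun h => by
  simpa [h] using im_pos hφ hc hz

theorem logDeriv_differentiableOn (hφ : φ ∈ PickClass) (h0 : ∀ z : ℂ, z.im ≠ 0 → φ z ≠ 0) :
    DifferentiableOn ℂ (logDeriv φ) {z : ℂ | z.im ≠ 0} :=
  (hφ.1.deriv (isOpen_ne_fun continuous_im continuous_const)).div hφ.1 h0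

theorem logDeriv_conj (hφ : φ ∈ PickClass) {z : ℂ} (hz : z.im < 0) :
    logDeriv φ z = conj (logDeriv φ (conj z)) := by
  have hev : φ =ᶠ[nhds z] conj ∘ φ ∘ conj := by
    filter_upwards [(isOpen_lt continuous_im continuous_const).mem_nhds hz] with w hw
    exact hφ.2.2 w hw
  rw [logDeriv_apply, logDeriv_apply, hev.deriv_eq, hφ.2.2 z hz, deriv_conj_conj, map_div₀]
  rfl

/-- For a non-constant Pick function, membership in `PickLogClass` only has to be tested through
the sign of the imaginary part of the logarithmic derivative on the upper half-plane. -/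
theorem mem_pickLogClass_iff_nonneg (hφ : φ ∈ PickClass)
    (hc : ¬ ∃ c : ℂ, ∀ z : ℂ, 0 < z.im → φ z = c) :
    φ ∈ PickLogClass ↔ ∀ z : ℂ, 0 < z.im → 0 ≤ (logDeriv φ z).im := by
  refine ⟨fun h z hz => im_nonneg h.2.2 hz, fun h => ?_⟩
  have h0 : ∀ z : ℂ, z.im ≠ 0 → φ z ≠ 0 := by
    intro z hz
    rcases hz.lt_or_gt with hz | hz
    · rw [hφ.2.2 z hz, ne_eq, map_eq_zero]
      exact ne_zero hφ hc (by simpa using hz)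
    · exact ne_zero hφ hc hz
  refine ⟨hφ, h0, logDeriv_differentiableOn hφ h0, fun z hz => ?_, fun z hz => logDeriv_conj hφ hz⟩
  rcases hz.lt_or_gt with hz | hz
  · refine div_nonneg_of_nonpos ?_ hz.le
    rw [logDeriv_conj hφ hz, conj_im]
    exact neg_nonpos.2 (h _ (by simpa using hz))
  · exact div_nonneg (h z hz) hz.le

/-- The logarithmic derivative of a non-constant Pick function is not a real constant: the function
would be a multiple of `exp (r z)`, which changes sign along vertical lines unless `r = 0`. -/
theorem not_logDeriv_eq_ofReal (hφ : φ ∈ PickClass)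
    (hc : ¬ ∃ c : ℂ, ∀ z : ℂ, 0 < z.im → φ z = c) (r : ℝ)
    (hr : ∀ z : ℂ, 0 < z.im → logDeriv φ z = r) : False := by
  have hexp : ∀ z : ℂ, HasDerivAt (fun z : ℂ => exp (r * z)) (exp (r * z) * r) z := fun z => by
    simpa using ((hasDerivAt_id z).const_mul (r : ℂ)).cexp
  obtain ⟨A, -, hA⟩ := (logDeriv_eqOn_iff (f := φ) (g := fun z : ℂ => exp (r * z))
    (s := {z : ℂ | 0 < z.im})
    (fun _ hw => (differentiableAt hφ (ne_of_gt hw)).differentiableWithinAt)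
    (fun w _ => (hexp w).differentiableAt.differentiableWithinAt)
    (isOpen_lt continuous_const continuous_im) (convex_halfSpace_im_gt 0).isPreconnected
    (fun _ _ => exp_ne_zero _) (fun _ hw => ne_zero hφ hc hw)).1 (fun z hz => by
      rw [hr z hz, logDeriv_apply, (hexp z).deriv, mul_div_cancel_left₀ _ (exp_ne_zero _)])
  replace hA : ∀ z : ℂ, 0 < z.im → φ z = A * exp (r * z) := fun z hz => hA hz
  rcases eq_or_ne r 0 with rfl | hr0
  · exact hc ⟨A, fun z hz => by simpa using hA z hz⟩
  -- Moving up by `π / |r|` multiplies `exp (r z)` by `exp (± π I) = -1`.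
  have him : 0 < (I + (Real.pi / |r| : ℝ) * I).im := by
    have : 0 < Real.pi / |r| := div_pos Real.pi_pos (abs_pos.2 hr0)
    simp only [add_im, I_im, im_ofReal_mul, mul_one]
    positivity
  have hI : 0 < I.im := by simp
  have hneg : φ (I + (Real.pi / |r| : ℝ) * I) = -φ I := by
    rw [hA _ him, hA _ hI]
    rcases hr0.lt_or_gt with h | h
    · have : (r : ℂ) * (I + (Real.pi / |r| : ℝ) * I) = r * I - Real.pi * I := by
        have : (r : ℂ) ≠ 0 := ofReal_ne_zero.2 hr0
        rw [abs_of_neg h]; push_cast; field_simp; ring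
      rw [this, exp_sub, exp_pi_mul_I]; ring
    · have : (r : ℂ) * (I + (Real.pi / |r| : ℝ) * I) = r * I + Real.pi * I := by
        have : (r : ℂ) ≠ 0 := ofReal_ne_zero.2 hr0
        rw [abs_of_pos h]; push_cast; field_simp
      rw [this, exp_add, exp_pi_mul_I]; ring
  have h1 := im_pos hφ hc him
  rw [hneg, neg_im] at h1
  linarith [im_pos hφ hc hI]

/-- Supplies the strict inequalities: if `φ'/φ` is constant, the constant is not real by
`not_logDeriv_eq_ofReal`. -/
theorem mem_pickLogClass_iff_pos (hφ : φ ∈ PickClass)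
    (hc : ¬ ∃ c : ℂ, ∀ z : ℂ, 0 < z.im → φ z = c) :
    φ ∈ PickLogClass ↔ ∀ z : ℂ, 0 < z.im → 0 < (logDeriv φ z).im := by
  refine ⟨fun h z hz => ?_, fun h => (mem_pickLogClass_iff_nonneg hφ hc).2 fun z hz => (h z hz).le⟩
  rcases im_pos_or_const_of_im_nonneg
    (fun w hw => (differentiableAt h.2.2 (ne_of_gt hw)).differentiableWithinAt)
    (fun w hw => im_nonneg h.2.2 hw) with ⟨c, hcst⟩ | hpos
  · rw [hcst z hz]
    refine lt_of_le_of_ne (hcst z hz ▸ im_nonneg h.2.2 hz) fun hc0 => ?_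
    exact not_logDeriv_eq_ofReal hφ hc c.re fun w hw => by
      rw [hcst w hw]; exact Complex.ext rfl (by simpa using hc0.symm)
  · exact hpos z hz

theorem hasDerivAt_vertical (hφ : φ ∈ PickClass) (x : ℝ) {y : ℝ} (hy : 0 < y) :
    HasDerivAt (fun t : ℝ => φ (x + t * I)) (deriv φ (x + y * I) * I) y := by
  have hline : HasDerivAt (fun t : ℝ => (x : ℂ) + t * I) I y := by
    simpa using ((hasDerivAt_id (y : ℂ)).comp_ofReal.mul_const I).const_add (x : ℂ)
  exact (differentiableAt hφ (by simpa using hy.ne')).hasDerivAt.comp y hline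

theorem hasDerivAt_horizontal (hφ : φ ∈ PickClass) (x : ℝ) {y : ℝ} (hy : 0 < y) :
    HasDerivAt (fun t : ℝ => φ (t + y * I)) (deriv φ (x + y * I)) x := by
  have hline : HasDerivAt (fun t : ℝ => (t : ℂ) + y * I) 1 x := by
    simpa using (hasDerivAt_id (x : ℂ)).comp_ofReal.add_const (y * I)
  exact ((differentiableAt hφ (by simpa using hy.ne')).hasDerivAt.comp x hline).congr_deriv
    (mul_one _)

/-- Real part of the chain rule for `log φ`; the vertical direction contributes the factor `I`, and
`Re (w I) = -Im w`. -/
theorem hasDerivAt_log_norm_vertical (hφ : φ ∈ PickClass)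
    (hc : ¬ ∃ c : ℂ, ∀ z : ℂ, 0 < z.im → φ z = c) (x : ℝ) {y : ℝ} (hy : 0 < y) :
    HasDerivAt (fun t : ℝ => Real.log ‖φ (x + t * I)‖) (-(logDeriv φ (x + y * I)).im) y := by
  have hs : φ (x + y * I) ∈ slitPlane := Or.inr (im_pos hφ hc (by simpa using hy)).ne'
  simp_rw [← log_re]
  refine (reCLM.hasFDerivAt.comp_hasDerivAt y
    ((hasDerivAt_vertical hφ x hy).clog_real hs)).congr_deriv ?_
  rw [logDeriv_apply, mul_div_right_comm, reCLM_apply, mul_I_re]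

theorem hasDerivAt_arg_horizontal (hφ : φ ∈ PickClass)
    (hc : ¬ ∃ c : ℂ, ∀ z : ℂ, 0 < z.im → φ z = c) (x : ℝ) {y : ℝ} (hy : 0 < y) :
    HasDerivAt (fun t : ℝ => arg (φ (t + y * I))) (logDeriv φ (x + y * I)).im x := by
  have hs : φ (x + y * I) ∈ slitPlane := Or.inr (im_pos hφ hc (by simpa using hy)).ne'
  simp_rw [← log_im]
  exact imCLM.hasFDerivAt.comp_hasDerivAt x ((hasDerivAt_horizontal hφ x hy).clog_real hs)

/-- `U U_y + V V_y = -|φ|² Im (φ'/φ)`. -/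
theorem pickU_mul_deriv_add (hφ : φ ∈ PickClass)
    (hc : ¬ ∃ c : ℂ, ∀ z : ℂ, 0 < z.im → φ z = c) (x : ℝ) {y : ℝ} (hy : 0 < y) :
    pickU φ x y * deriv (fun t : ℝ => pickU φ x t) y +
      pickV φ x y * deriv (fun t : ℝ => pickV φ x t) y =
    -(normSq (φ (x + y * I)) * (logDeriv φ (x + y * I)).im) := by
  have hU : HasDerivAt (fun t : ℝ => pickU φ x t) (deriv φ (x + y * I) * I).re y :=
    reCLM.hasFDerivAt.comp_hasDerivAt y (hasDerivAt_vertical hφ x hy)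
  have hV : HasDerivAt (fun t : ℝ => pickV φ x t) (deriv φ (x + y * I) * I).im y :=
    imCLM.hasFDerivAt.comp_hasDerivAt y (hasDerivAt_vertical hφ x hy)
  have h0 : normSq (φ (x + y * I)) ≠ 0 :=
    normSq_eq_zero.not.2 (ne_zero hφ hc (by simpa using hy))
  rw [hU.deriv, hV.deriv, logDeriv_apply, div_im, pickU, pickV]
  field_simp
  simp
  ring

end PickClass

/-- In the upper half-plane, arguments are compared by the sign of a determinant. -/
theorem arg_lt_arg_iff_of_im_pos {z w : ℂ} (hz : 0 < z.im) (hw : 0 < w.im) :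
    arg z < arg w ↔ 0 < z.re * w.im - w.re * z.im := by
  have hz0 : 0 < ‖z‖ := norm_pos_iff.2 fun h => by simp [h] at hz
  have hw0 : 0 < ‖w‖ := norm_pos_iff.2 fun h => by simp [h] at hw
  have key : z.re * w.im - w.re * z.im = ‖z‖ * ‖w‖ * Real.sin (arg w - arg z) := by
    rw [Real.sin_sub]
    nth_rw 1 [← norm_mul_cos_arg z, ← norm_mul_cos_arg w, ← norm_mul_sin_arg z, ← norm_mul_sin_arg w]
    ring
  have hz1 := arg_nonneg_iff.2 hz.le
  have hw1 := arg_nonneg_iff.2 hw.le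
  have hz2 := arg_lt_pi_iff.2 (Or.inr hz.ne')
  have hw2 := arg_lt_pi_iff.2 (Or.inr hw.ne')
  -- Both arguments lie in `(0, π)`, so their difference lies in `(-π, π)`, where sine has the sign
  -- of its argument.
  rw [key, mul_pos_iff_of_pos_left (mul_pos hz0 hw0)]
  constructor
  · intro h
    exact Real.sin_pos_of_pos_of_lt_pi (by linarith) (by linarith)
  · intro h
    by_contra! hle
    exact absurd h (not_lt.2 (Real.sin_nonpos_of_nonpos_of_neg_pi_le (by linarith) (by linarith)))

theorem theorem2p5 (φ : ℂ → ℂ) (hφ : φ ∈ PickClass)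
    (hconst : ¬ ∃ c : ℂ, ∀ z : ℂ, 0 < z.im → φ z = c) :
    (φ ∈ PickLogClass ↔
      ∀ x y₁ y₂ : ℝ, 0 < y₁ → y₁ < y₂ →
        ‖φ ((x : ℂ) + (y₁ : ℂ) * Complex.I)‖ > ‖φ ((x : ℂ) + (y₂ : ℂ) * Complex.I)‖) ∧
    (φ ∈ PickLogClass ↔
      ∀ y x₁ x₂ : ℝ, 0 < y → x₁ < x₂ →
        Complex.arg (φ ((x₁ : ℂ) + (y : ℂ) * Complex.I)) <
          Complex.arg (φ ((x₂ : ℂ) + (y : ℂ) * Complex.I))) ∧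
    (φ ∈ PickLogClass ↔
      ∀ y x₁ x₂ : ℝ, 0 < y → x₁ < x₂ →
        Matrix.det !![pickU φ x₁ y, pickU φ x₂ y; pickV φ x₁ y, pickV φ x₂ y] > 0) ∧
    (φ ∈ PickLogClass ↔
      ∀ x y : ℝ, 0 < y →
        pickU φ x y * deriv (fun t : ℝ => pickU φ x t) y +
          pickV φ x y * deriv (fun t : ℝ => pickV φ x t) y < 0) := by
  have him : ∀ x y : ℝ, 0 < y → 0 < ((x : ℂ) + (y : ℂ) * I).im := fun x y hy => by simpa using hy
  have hz : ∀ z : ℂ, z = (z.re : ℂ) + (z.im : ℂ) * I := fun z => (re_add_im z).symm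
  have hnorm : ∀ x y : ℝ, 0 < y → 0 < ‖φ ((x : ℂ) + (y : ℂ) * I)‖ := fun x y hy =>
    norm_pos_iff.2 (PickClass.ne_zero hφ hconst (him x y hy))
  have harg : φ ∈ PickLogClass ↔ ∀ y x₁ x₂ : ℝ, 0 < y → x₁ < x₂ →
      arg (φ ((x₁ : ℂ) + (y : ℂ) * I)) < arg (φ ((x₂ : ℂ) + (y : ℂ) * I)) := by
    constructor
    · intro h y x₁ x₂ hy hx
      exact strictMono_of_hasDerivAt_pos
        (fun x => PickClass.hasDerivAt_arg_horizontal hφ hconst x hy)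
        (fun x => (PickClass.mem_pickLogClass_iff_pos hφ hconst).1 h _ (him x y hy)) hx
    · intro h
      refine (PickClass.mem_pickLogClass_iff_nonneg hφ hconst).2 fun z hz0 => ?_
      rw [hz z, ← (PickClass.hasDerivAt_arg_horizontal hφ hconst z.re hz0).deriv]
      have hmono : StrictMono fun t : ℝ => arg (φ ((t : ℂ) + (z.im : ℂ) * I)) :=
        fun x₁ x₂ hx => h z.im x₁ x₂ hz0 hx
      exact hmono.monotone.deriv_nonneg
  refine ⟨⟨fun h x y₁ y₂ hy₁ hy => ?_, fun h => ?_⟩, harg, harg.trans ?_,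
    (PickClass.mem_pickLogClass_iff_pos hφ hconst).trans ⟨fun h x y hy => ?_, fun h z hz0 => ?_⟩⟩
  · refine (Real.log_lt_log_iff (hnorm x y₂ (hy₁.trans hy)) (hnorm x y₁ hy₁)).1 ?_
    refine strictAntiOn_of_hasDerivWithinAt_neg (convex_Ioi (0 : ℝ))
      (fun t ht => (PickClass.hasDerivAt_log_norm_vertical hφ hconst x
        ht).continuousAt.continuousWithinAt)
      (fun t ht => (PickClass.hasDerivAt_log_norm_vertical hφ hconst x
        (interior_subset ht)).hasDerivWithinAt)
      (fun t ht => ?_) hy₁ (hy₁.trans hy) hy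
    exact neg_neg_of_pos ((PickClass.mem_pickLogClass_iff_pos hφ hconst).1 h _
      (him x t (interior_subset ht)))
  · refine (PickClass.mem_pickLogClass_iff_nonneg hφ hconst).2 fun z hz0 => ?_
    have hanti : AntitoneOn (fun t : ℝ => Real.log ‖φ ((z.re : ℂ) + (t : ℂ) * I)‖) (Ioi 0) :=
      StrictAntiOn.antitoneOn fun y₁ hy₁ y₂ hy₂ hy =>
        Real.log_lt_log (hnorm _ _ hy₂) (h z.re y₁ y₂ hy₁ hy)
    -- Monotonicity is known only for `t > 0`, hence the derivative within `Ioi 0`, which is the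
    -- ordinary one since that set is open.
    have hle := hanti.derivWithin_nonpos (x := z.im)
    rw [derivWithin_of_isOpen isOpen_Ioi hz0,
      (PickClass.hasDerivAt_log_norm_vertical hφ hconst z.re hz0).deriv, ← hz z] at hle
    exact neg_nonpos.1 hle
  · refine forall₃_congr fun y x₁ x₂ => forall₂_congr fun hy _ => ?_
    rw [arg_lt_arg_iff_of_im_pos (PickClass.im_pos hφ hconst (him x₁ y hy))
      (PickClass.im_pos hφ hconst (him x₂ y hy)), Matrix.det_fin_two_of]
    rfl
  · rw [PickClass.pickU_mul_deriv_add hφ hconst x hy]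
    exact neg_neg_of_pos (mul_pos (normSq_pos.2 (PickClass.ne_zero hφ hconst (him x y hy)))
      (h _ (him x y hy)))
  · have h4 := h z.re z.im hz0
    rw [PickClass.pickU_mul_deriv_add hφ hconst z.re hz0, ← hz z, neg_lt_zero] at h4
    exact pos_of_mul_pos_right h4 (normSq_nonneg _)
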